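/- All graphs are finite, simple and undirected. For a vertex $v$ of a graph $G$ and an integer $k\ge 0$, let $w_G^k(v)$ be the number of walks of length $k$ in $G$ starting at $v$, and let $r_G^k(v)$ be the number of closed walks of length $k$ in $G$ starting and ending at $v$. Vertices $v\in V(G)$ and $u\in V(H)$ are called walk-equivalent if $w_G^k(v)=w_H^k(u)$ for all $k$, and closed-walk-equivalent if $r_G^k(v)=r_H^k(u)$ for all $k$. 1. Let $G$ and $H$ be connected graphs on $n$ and $m$ vertices respectively. Two vertices $v\in V(G)$ and $u\in V(H)$ are walk-equivalent if and only if $w_G^k(v)=w_H^k(u)$ for all $k<n+m$. Similarly, they are closed-walk-equivalent if and only if $r_G^k(v)=r_H^k(u)$ for all $k<n+m$. 2. On the other hand, for each $n\ge 2$ there are $n$-vertex graphs $G$ and $H$, which are connected if $n\ge 3$, with vertices $v\in V(G)$ and $u\in V(H)$ such that $v$ and $u$ are not closed-walk-equivalent while $r_G^k(v)=r_H^k(u)$ for all $k\le 2n-5$. 3. Also, for each $n\ge 2$ there are $n$-vertex graphs $G$ and $H$, which are connected if $n\ge 3$, with vertices $v\in V(G)$ and $u\in V(H)$ such that $v$ and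 $u$ are not walk-equivalent while $w_G^k(v)=w_H^k(u)$ for all $k<2n-16\sqrt n$. -/

import Mathlib

/-- `walkCount G v k` is the number of walks of length `k` in `G` starting at `v`
(with arbitrary end vertex). -/
noncomputable def walkCount {V : Type*} (G : SimpleGraph V) (v : V) (k : ℕ) : ℕ :=
  Nat.card {p : Σ u : V, G.Walk v u // p.2.length = k}

/-- `closedWalkCount G v k` is the number of closed walks of length `k` in `G`
starting and ending at `v`. -/
noncomputable def closedWalkCount {V : Type*} (G : SimpleGraph V) (v : V) (k : ℕ) : ℕ :=
  Nat.card {p : G.Walk v v // p.length = k}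

/-- The vertices `v` of `G` and `u` of `H` are walk-equivalent: for every length `k`, they have
the same number of walks of length `k` emanating from them. -/
def WalkEquivalent {V W : Type*} (G : SimpleGraph V) (H : SimpleGraph W) (v : V) (u : W) : Prop :=
  ∀ k : ℕ, walkCount G v k = walkCount H u k

/-- The vertices `v` of `G` and `u` of `H` are closed-walk-equivalent: for every length `k`, they
have the same number of closed walks of length `k` emanating from them. -/
def ClosedWalkEquivalent {V W : Type*} (G : SimpleGraph V) (H : SimpleGraph W) (v : V) (u : W) :
    Prop :=
  ∀ k : ℕ, closedWalkCount G v k = closedWalkCount H u k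

/-! Part 1 is Cayley–Hamilton: both counts are fixed linear functionals of powers of the adjacency
matrix, and the product of the two characteristic polynomials is monic of degree n + m and
annihilates both matrices, so `linear_pow_eq_of_lt` reduces every power to lower ones.

Part 2 uses locality. If two graphs agree up to level R around v, cutting a closed walk at its
midpoint shows that closed walks of length at most 2R + 1 agree, and expresses the difference at
length 2R + 2 through squares of walk counts beyond level R. A path seen from its end, and the same
path with its last edge moved back by one vertex, attain this with R = n - 3.

Part 3 turns closed walks into walks. Suppose one family f k x satisfies the walk-count recursion of
both G and H except for a common error g k at v. Then the walk counts at v are determined by f, g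
and the closed-walk counts at v, and if g 0 ≠ 0 they first differ one step after the closed-walk
counts (`sum_adjMatrix_pow_of_common_profile`). Here f comes from a periodic bi-infinite chain of
hexagons. Its reflection symmetry allows the finite chain to end in a triangle, a hexagon folded in
half, and allows two far edges to be switched between vertices of equal profile, all without
disturbing f. Position 0, with its leaves, carries the error. In `chain_closedWalks` the switch
splits a + b walks arriving at one vertex into a and b arriving at two, and (a + b)² ≠ a² + b². With
about √n hexagons spaced about √n apart, the switch is at distance n - O(√n) from v. -/

/-! ### Walk counts as matrix entries, and the bound n + m. -/

section Counting

variable {V W : Type*} [Fintype V] [Fintype W] [DecidableEq V] [DecidableEq W]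

theorem natCard_walk_eq_adjMatrix_pow (G : SimpleGraph V) [DecidableRel G.Adj] (v x : V) (k : ℕ) :
    (Nat.card {p : G.Walk v x // p.length = k} : ℤ) = (G.adjMatrix ℤ ^ k) v x := by
  rw [SimpleGraph.adjMatrix_pow_apply_eq_card_walk, ← Nat.card_eq_fintype_card]
  rfl

theorem closedWalkCount_eq_adjMatrix_pow (G : SimpleGraph V) [DecidableRel G.Adj] (v : V) (k : ℕ) :
    (closedWalkCount G v k : ℤ) = (G.adjMatrix ℤ ^ k) v v :=
  natCard_walk_eq_adjMatrix_pow G v v k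

theorem walkCount_eq_sum_adjMatrix_pow (G : SimpleGraph V) [DecidableRel G.Adj] (v : V) (k : ℕ) :
    (walkCount G v k : ℤ) = ∑ x, (G.adjMatrix ℤ ^ k) v x := by
  let e : {p : Σ u : V, G.Walk v u // p.2.length = k} ≃
      Σ u : V, {p : G.Walk v u // p.length = k} :=
    { toFun := fun p => ⟨p.1.1, p.1.2, p.2⟩
      invFun := fun p => ⟨⟨p.1, p.2.1⟩, p.2.2⟩
      left_inv := fun _ => rfl
      right_inv := fun _ => rfl }
  have hf (u : V) : Finite {p : G.Walk v u // p.length = k} :=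
    Finite.of_fintype {p : G.Walk v u | p.length = k}
  rw [walkCount, Nat.card_congr e, Nat.card_sigma]
  push_cast
  exact Finset.sum_congr rfl fun x _ => natCard_walk_eq_adjMatrix_pow G v x k

/-- Two linear functionals on matrices that agree on the first `card V + card W` powers of `A` and
`B` agree on all of them. -/
theorem linear_pow_eq_of_lt (A : Matrix V V ℤ) (B : Matrix W W ℤ)
    (φ : Matrix V V ℤ →ₗ[ℤ] ℤ) (ψ : Matrix W W ℤ →ₗ[ℤ] ℤ)
    (h : ∀ k < Fintype.card V + Fintype.card W, φ (A ^ k) = ψ (B ^ k)) (k : ℕ) :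
    φ (A ^ k) = ψ (B ^ k) := by
  open Polynomial in
  -- One monic polynomial annihilates both matrices, so division with remainder over ℤ replaces both
  -- k-th powers by the same remainder `q`.
  let p : ℤ[X] := A.charpoly * B.charpoly
  have hp : p.Monic := A.charpoly_monic.mul B.charpoly_monic
  have hdeg : p.natDegree = Fintype.card V + Fintype.card W := by
    rw [A.charpoly_monic.natDegree_mul B.charpoly_monic, A.charpoly_natDegree_eq_dim,
      B.charpoly_natDegree_eq_dim]
  let q := (X ^ k : ℤ[X]) %ₘ p
  have hX : (X ^ k : ℤ[X]) = q + p * (X ^ k /ₘ p) := (modByMonic_add_div _ p).symm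
  have hA : A ^ k = aeval A q := by
    have := congrArg (aeval A) hX
    simpa [p, Matrix.aeval_self_charpoly] using this
  have hB : B ^ k = aeval B q := by
    have := congrArg (aeval B) hX
    simpa [p, Matrix.aeval_self_charpoly] using this
  have hq : ∀ i ∈ q.support, i < Fintype.card V + Fintype.card W := by
    intro i hi
    have h1 : q.degree < p.degree := degree_modByMonic_lt _ hp
    have h2 : (i : WithBot ℕ) ≤ q.degree := le_degree_of_mem_supp i hi
    rw [degree_eq_natDegree hp.ne_zero, hdeg] at h1
    exact_mod_cast h2.trans_lt h1
  rw [hA, hB, aeval_eq_sum_range, aeval_eq_sum_range, map_sum, map_sum]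
  refine Finset.sum_congr rfl fun i _ => ?_
  rw [map_smul, map_smul]
  by_cases hi : i ∈ q.support
  · rw [h i (hq i hi)]
  · rw [notMem_support_iff.mp hi, zero_smul, zero_smul]

end Counting

theorem walkEquivalent_iff_lt_card {V W : Type*} [Fintype V] [Fintype W] (G : SimpleGraph V)
    (H : SimpleGraph W) (v : V) (u : W) :
    WalkEquivalent G H v u ↔
      ∀ k < Fintype.card V + Fintype.card W, walkCount G v k = walkCount H u k := by
  classical
  refine ⟨fun h k _ => h k, fun h k => ?_⟩
  let φ : Matrix V V ℤ →ₗ[ℤ] ℤ :=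
    { toFun := fun M => ∑ x, M v x
      map_add' := fun _ _ => by simp [Finset.sum_add_distrib]
      map_smul' := fun _ _ => by simp [Finset.mul_sum] }
  let ψ : Matrix W W ℤ →ₗ[ℤ] ℤ :=
    { toFun := fun M => ∑ x, M u x
      map_add' := fun _ _ => by simp [Finset.sum_add_distrib]
      map_smul' := fun _ _ => by simp [Finset.mul_sum] }
  have key := linear_pow_eq_of_lt (G.adjMatrix ℤ) (H.adjMatrix ℤ) φ ψ (fun k hk => by
    have := congrArg (Nat.cast (R := ℤ)) (h k hk)
    rwa [walkCount_eq_sum_adjMatrix_pow, walkCount_eq_sum_adjMatrix_pow] at this) k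
  zify
  rw [walkCount_eq_sum_adjMatrix_pow, walkCount_eq_sum_adjMatrix_pow]
  exact key

theorem closedWalkEquivalent_iff_lt_card {V W : Type*} [Fintype V] [Fintype W] (G : SimpleGraph V)
    (H : SimpleGraph W) (v : V) (u : W) :
    ClosedWalkEquivalent G H v u ↔
      ∀ k < Fintype.card V + Fintype.card W, closedWalkCount G v k = closedWalkCount H u k := by
  classical
  refine ⟨fun h k _ => h k, fun h k => ?_⟩
  have key := linear_pow_eq_of_lt (G.adjMatrix ℤ) (H.adjMatrix ℤ)
    (Matrix.entryLinearMap ℤ ℤ v v) (Matrix.entryLinearMap ℤ ℤ u u) (fun k hk => by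
    have := congrArg (Nat.cast (R := ℤ)) (h k hk)
    rwa [closedWalkCount_eq_adjMatrix_pow, closedWalkCount_eq_adjMatrix_pow] at this) k
  zify
  rw [closedWalkCount_eq_adjMatrix_pow, closedWalkCount_eq_adjMatrix_pow]
  exact key

/-! ### Two graphs that agree near a vertex. -/

section Levels

variable {V : Type*} [Fintype V] [DecidableEq V] {G H : SimpleGraph V}
  [DecidableRel G.Adj] [DecidableRel H.Adj] {v : V} {d : V → ℕ} {R : ℕ}

theorem adjMatrix_pow_succ_apply (G : SimpleGraph V) [DecidableRel G.Adj] (v x : V) (k : ℕ) :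
    (G.adjMatrix ℤ ^ (k + 1)) v x = ∑ y, if G.Adj y x then (G.adjMatrix ℤ ^ k) v y else 0 := by
  simp [pow_succ, Matrix.mul_apply, SimpleGraph.adjMatrix_apply]

theorem adjMatrix_pow_symm (G : SimpleGraph V) [DecidableRel G.Adj] (x y : V) (k : ℕ) :
    (G.adjMatrix ℤ ^ k) x y = (G.adjMatrix ℤ ^ k) y x :=
  ((SimpleGraph.isSymm_adjMatrix (α := ℤ) G).pow k).apply y x

theorem adjMatrix_pow_add_apply_self (G : SimpleGraph V) [DecidableRel G.Adj] (v : V) (i j : ℕ) :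
    (G.adjMatrix ℤ ^ (i + j)) v v =
      ∑ x, (G.adjMatrix ℤ ^ i) v x * (G.adjMatrix ℤ ^ j) v x := by
  rw [pow_add, Matrix.mul_apply]
  exact Finset.sum_congr rfl fun x _ => by rw [adjMatrix_pow_symm G x v j]

/-- A walk climbs at most one level per step. The labelling `d` need not be the distance from `v`;
any such lower bound will do, so it can be truncated to suit two graphs at once. -/
theorem adjMatrix_pow_eq_zero_of_level (hv : d v = 0) (hG : ∀ x y, G.Adj x y → d y ≤ d x + 1) :
    ∀ (k : ℕ) (x : V), k < d x → (G.adjMatrix ℤ ^ k) v x = 0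
  | 0, x, hx => by
    have : v ≠ x := by rintro rfl; omega
    simp [this]
  | k + 1, x, hx => by
    rw [adjMatrix_pow_succ_apply]
    refine Finset.sum_eq_zero fun y _ => ?_
    split_ifs with h
    · exact adjMatrix_pow_eq_zero_of_level hv hG k y (by have := hG y x h; omega)
    · rfl

theorem adjMatrix_pow_congr_of_level (hv : d v = 0) (hG : ∀ x y, G.Adj x y → d y ≤ d x + 1)
    (hH : ∀ x y, H.Adj x y → d y ≤ d x + 1)
    (hGH : ∀ x y, d x ≤ R → d y ≤ R → (G.Adj x y ↔ H.Adj x y)) :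
    ∀ k ≤ R, ∀ x, (G.adjMatrix ℤ ^ k) v x = (H.adjMatrix ℤ ^ k) v x
  | 0, _, x => by simp
  | k + 1, hk, x => by
    rw [adjMatrix_pow_succ_apply, adjMatrix_pow_succ_apply]
    refine Finset.sum_congr rfl fun y _ => ?_
    rw [adjMatrix_pow_congr_of_level hv hG hH hGH k (by omega) y]
    by_cases hy : k < d y
    · rw [adjMatrix_pow_eq_zero_of_level hv hH k y hy]; simp
    · by_cases hx : d x ≤ R
      · simp only [hGH y x (by omega) hx]
      · have h1 : ¬ G.Adj y x := fun h => by have := hG y x h; omega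
        have h2 : ¬ H.Adj y x := fun h => by have := hH y x h; omega
        simp [h1, h2]

/-- Before its last step the walk is still within level `R`, so only a step leaving that region can
distinguish the graphs. -/
theorem adjMatrix_pow_succ_congr_of_level (hv : d v = 0)
    (hG : ∀ x y, G.Adj x y → d y ≤ d x + 1) (hH : ∀ x y, H.Adj x y → d y ≤ d x + 1)
    (hGH : ∀ x y, d x ≤ R → d y ≤ R → (G.Adj x y ↔ H.Adj x y)) (x : V) (hx : d x ≤ R) :
    (G.adjMatrix ℤ ^ (R + 1)) v x = (H.adjMatrix ℤ ^ (R + 1)) v x := by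
  rw [adjMatrix_pow_succ_apply, adjMatrix_pow_succ_apply]
  refine Finset.sum_congr rfl fun y _ => ?_
  rw [adjMatrix_pow_congr_of_level hv hG hH hGH R le_rfl y]
  by_cases hy : R < d y
  · rw [adjMatrix_pow_eq_zero_of_level hv hH R y hy]; simp
  · simp only [hGH y x (by omega) hx]

/-- If two graphs agree up to distance `R` from `v`, then the numbers of closed walks at `v` agree
up to length `2 * R + 1`. -/
theorem adjMatrix_pow_self_congr_of_level (hv : d v = 0)
    (hG : ∀ x y, G.Adj x y → d y ≤ d x + 1) (hH : ∀ x y, H.Adj x y → d y ≤ d x + 1)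
    (hGH : ∀ x y, d x ≤ R → d y ≤ R → (G.Adj x y ↔ H.Adj x y)) (k : ℕ) (hk : k ≤ 2 * R + 1) :
    (G.adjMatrix ℤ ^ k) v v = (H.adjMatrix ℤ ^ k) v v := by
  have hlow := adjMatrix_pow_congr_of_level hv hG hH hGH
  obtain hk | rfl := hk.lt_or_eq
  · obtain ⟨i, j, rfl, hi, hj⟩ : ∃ i j, k = i + j ∧ i ≤ R ∧ j ≤ R :=
      ⟨min k R, k - min k R, by omega, by omega, by omega⟩
    rw [adjMatrix_pow_add_apply_self, adjMatrix_pow_add_apply_self]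
    exact Finset.sum_congr rfl fun x _ => by rw [hlow i hi, hlow j hj]
  -- In the odd case the factor of length `R` vanishes beyond level `R`, exactly where the factors
  -- of length `R + 1` may disagree.
  · rw [show 2 * R + 1 = R + (R + 1) by ring, adjMatrix_pow_add_apply_self,
      adjMatrix_pow_add_apply_self]
    refine Finset.sum_congr rfl fun x _ => ?_
    rw [hlow R le_rfl]
    by_cases hx : d x ≤ R
    · rw [adjMatrix_pow_succ_congr_of_level hv hG hH hGH x hx]
    · rw [adjMatrix_pow_eq_zero_of_level hv hH R x (by omega)]; simp

/-- Both halves of the walk have length `R + 1`, so the counts of midpoints appear squared and the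
midpoints within level `R` cancel. -/
theorem adjMatrix_pow_self_sub_of_level (hv : d v = 0)
    (hG : ∀ x y, G.Adj x y → d y ≤ d x + 1) (hH : ∀ x y, H.Adj x y → d y ≤ d x + 1)
    (hGH : ∀ x y, d x ≤ R → d y ≤ R → (G.Adj x y ↔ H.Adj x y)) :
    (G.adjMatrix ℤ ^ (2 * R + 2)) v v - (H.adjMatrix ℤ ^ (2 * R + 2)) v v =
      ∑ x with R < d x, ((G.adjMatrix ℤ ^ (R + 1)) v x ^ 2 - (H.adjMatrix ℤ ^ (R + 1)) v x ^ 2) := by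
  rw [show 2 * R + 2 = (R + 1) + (R + 1) by ring, adjMatrix_pow_add_apply_self,
    adjMatrix_pow_add_apply_self, ← Finset.sum_sub_distrib, Finset.sum_filter]
  refine Finset.sum_congr rfl fun x _ => ?_
  split_ifs with hx
  · ring
  · rw [adjMatrix_pow_succ_congr_of_level hv hG hH hGH x (by omega), sub_self]

theorem adjMatrix_pow_pos_of_walk {x : V} (p : G.Walk v x) :
    0 < (G.adjMatrix ℤ ^ p.length) v x := by
  rw [SimpleGraph.adjMatrix_pow_apply_eq_card_walk]
  have : Nonempty {q : G.Walk v x | q.length = p.length} := ⟨⟨p, rfl⟩⟩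
  exact_mod_cast Fintype.card_pos

end Levels

/-! ### Walk counts from closed-walk counts. -/

section Profile

variable {V : Type*} [Fintype V] [DecidableEq V]

/-- If `f` satisfies the recursion of the walk counts of `G` except for a defect `g` at `v`, then
the number of walks from `v` is obtained from `f` and `g` and the closed walks at `v`. -/
theorem sum_adjMatrix_pow_eq_of_profile (G : SimpleGraph V) [DecidableRel G.Adj] (v : V)
    (f : ℕ → V → ℤ) (g : ℕ → ℤ) (h0 : ∀ x, f 0 x = 1)
    (hs : ∀ k x, f (k + 1) x =
      (∑ y, if G.Adj x y then f k y else 0) + if x = v then g k else 0) (k : ℕ) :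
    ∑ x, (G.adjMatrix ℤ ^ k) v x =
      f k v - ∑ j ∈ Finset.range k, (G.adjMatrix ℤ ^ j) v v * g (k - 1 - j) := by
  -- Generalizing to a weight `f i` lets the induction trade one profile step for one matrix step,
  -- at the cost of one defect term at `v`.
  have main : ∀ i : ℕ, ∑ x, (G.adjMatrix ℤ ^ k) v x * f i x = f (k + i) v -
      ∑ j ∈ Finset.range k, (G.adjMatrix ℤ ^ j) v v * g (k + i - 1 - j) := by
    induction k with
    | zero => intro i; simp [Matrix.one_apply]
    | succ k ih =>
      intro i
      have h1 := ih (i + 1)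
      have h2 : ∑ x, (G.adjMatrix ℤ ^ k) v x * f (i + 1) x =
          ∑ x, (G.adjMatrix ℤ ^ (k + 1)) v x * f i x + (G.adjMatrix ℤ ^ k) v v * g i := by
        simp only [hs, mul_add, Finset.sum_add_distrib]
        congr 1
        · simp only [adjMatrix_pow_succ_apply, Finset.mul_sum, Finset.sum_mul]
          rw [Finset.sum_comm]
          refine Finset.sum_congr rfl fun x _ => Finset.sum_congr rfl fun y _ => ?_
          split_ifs <;> simp
        · simp
      rw [Finset.sum_range_succ]
      have e1 : k + 1 + i = k + (i + 1) := by ring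
      have e2 : k + (i + 1) - 1 - k = i := by omega
      rw [e1, e2]
      linarith
  simpa [h0] using main 0

/-- For two graphs with the same profile at `v` and a nontrivial defect there, the walk counts
first differ one step after the closed walk counts do. -/
theorem sum_adjMatrix_pow_of_common_profile {G H : SimpleGraph V} [DecidableRel G.Adj]
    [DecidableRel H.Adj] (v : V) (f : ℕ → V → ℤ) (g : ℕ → ℤ) (h0 : ∀ x, f 0 x = 1)
    (hG : ∀ k x, f (k + 1) x =
      (∑ y, if G.Adj x y then f k y else 0) + if x = v then g k else 0)
    (hH : ∀ k x, f (k + 1) x =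
      (∑ y, if H.Adj x y then f k y else 0) + if x = v then g k else 0)
    (hg : g 0 ≠ 0) (K : ℕ)
    (hlt : ∀ k < K, (G.adjMatrix ℤ ^ k) v v = (H.adjMatrix ℤ ^ k) v v)
    (hK : (G.adjMatrix ℤ ^ K) v v ≠ (H.adjMatrix ℤ ^ K) v v) :
    (∀ k ≤ K, ∑ x, (G.adjMatrix ℤ ^ k) v x = ∑ x, (H.adjMatrix ℤ ^ k) v x) ∧
      ∑ x, (G.adjMatrix ℤ ^ (K + 1)) v x ≠ ∑ x, (H.adjMatrix ℤ ^ (K + 1)) v x := by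
  constructor
  · intro k hk
    rw [sum_adjMatrix_pow_eq_of_profile G v f g h0 hG, sum_adjMatrix_pow_eq_of_profile H v f g h0 hH]
    congr 1
    refine Finset.sum_congr rfl fun j hj => ?_
    rw [hlt j (by have := Finset.mem_range.mp hj; omega)]
  · rw [sum_adjMatrix_pow_eq_of_profile G v f g h0 hG, sum_adjMatrix_pow_eq_of_profile H v f g h0 hH,
      Finset.sum_range_succ, Finset.sum_range_succ]
    have : ∑ j ∈ Finset.range K, (G.adjMatrix ℤ ^ j) v v * g (K + 1 - 1 - j) =
        ∑ j ∈ Finset.range K, (H.adjMatrix ℤ ^ j) v v * g (K + 1 - 1 - j) :=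
      Finset.sum_congr rfl fun j hj => by rw [hlt j (Finset.mem_range.mp hj)]
    -- The first differing closed-walk count enters with coefficient `g 0`.
    rw [this, show K + 1 - 1 - K = 0 by omega]
    intro h
    exact hK (mul_right_cancel₀ hg (by linarith))

end Profile

/-! ### Graphs given by increasing edges. -/

/-- The graph on `Fin n` whose edges are the pairs `i < j` with `E i j`. -/
def ascendingGraph (n : ℕ) (E : ℕ → ℕ → Prop) : SimpleGraph (Fin n) where
  Adj x y := (x.val < y.val ∧ E x y) ∨ (y.val < x.val ∧ E y x)
  symm := ⟨fun _ _ h => h.symm⟩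
  loopless := ⟨fun x h => by simp at h⟩

theorem ascendingGraph_adj {n : ℕ} {E : ℕ → ℕ → Prop} {x y : Fin n} :
    (ascendingGraph n E).Adj x y ↔
      (x.val < y.val ∧ E x y) ∨ (y.val < x.val ∧ E y x) := Iff.rfl

theorem ascendingGraph_exists_walk {n : ℕ} [NeZero n] {E : ℕ → ℕ → Prop} (d : ℕ → ℕ) (h0 : d 0 = 0)
    {b : ℕ} (hb : b < n)
    (hE : ∀ j ≤ b, 0 < j → ∃ i < j, E i j ∧ d j = d i + 1) (j : ℕ) (hj : j ≤ b) :
    ∃ p : (ascendingGraph n E).Walk 0 ⟨j, by omega⟩, p.length = d j := by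
  induction j using Nat.strong_induction_on with
  | _ j ih =>
    rcases Nat.eq_zero_or_pos j with rfl | hpos
    · exact ⟨SimpleGraph.Walk.nil, by simp [h0]⟩
    · obtain ⟨i, hi, hij, hd⟩ := hE j hj hpos
      obtain ⟨p, hp⟩ := ih i hi (by omega)
      have hadj : (ascendingGraph n E).Adj ⟨i, by omega⟩ ⟨j, by omega⟩ := Or.inl ⟨hi, hij⟩
      exact ⟨p.concat hadj, by rw [SimpleGraph.Walk.length_concat, hp, hd]⟩

theorem ascendingGraph_connected {n : ℕ} [NeZero n] {E : ℕ → ℕ → Prop}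
    (hE : ∀ j < n, 0 < j → ∃ i < j, E i j) : (ascendingGraph n E).Connected := by
  have h : ∀ j (hj : j < n), (ascendingGraph n E).Reachable 0 ⟨j, hj⟩ := by
    intro j
    induction j using Nat.strong_induction_on with
    | _ j ih =>
      intro hj
      rcases Nat.eq_zero_or_pos j with rfl | hpos
      · exact SimpleGraph.Reachable.refl _
      · obtain ⟨i, hi, hij⟩ := hE j hj hpos
        have hadj : (ascendingGraph n E).Adj ⟨i, by omega⟩ ⟨j, hj⟩ := Or.inl ⟨hi, hij⟩
        exact (ih i hi (by omega)).trans hadj.reachable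
  exact ⟨fun x y => (h x x.2).symm.trans (h y y.2)⟩

/-! ### The construction for closed walks. -/

/-- A path on `n` vertices and the path whose last edge is moved back by one vertex. -/
theorem exists_closedWalkCount_eq_of_le {n : ℕ} (hn : 3 ≤ n) :
    ∃ (G H : SimpleGraph (Fin n)) (v : Fin n), G.Connected ∧ H.Connected ∧
      ¬ ClosedWalkEquivalent G H v v ∧
      ∀ k ≤ 2 * n - 5, closedWalkCount G v k = closedWalkCount H v k := by
  classical
  obtain ⟨N, rfl⟩ := Nat.exists_eq_add_of_le' hn
  let E : ℕ → ℕ → Prop := fun i j => j = i + 1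
  let E' : ℕ → ℕ → Prop := fun i j => (j = i + 1 ∧ i ≠ N + 1) ∨ (i = N ∧ j = N + 2)
  let G := ascendingGraph (N + 3) E
  let H := ascendingGraph (N + 3) E'
  -- The last vertex is at distance N + 2 in `G` but N + 1 in `H`; truncation gives a labelling
  -- valid for both.
  let d : Fin (N + 3) → ℕ := fun x => min x.val (N + 1)
  have hv : d 0 = 0 := by simp [d]
  have hG : ∀ x y, G.Adj x y → d y ≤ d x + 1 := by
    intro x y h
    simp only [G, ascendingGraph_adj, E] at h
    simp only [d]
    omega
  have hH : ∀ x y, H.Adj x y → d y ≤ d x + 1 := by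
    intro x y h
    simp only [H, ascendingGraph_adj, E'] at h
    simp only [d]
    omega
  have hGH : ∀ x y, d x ≤ N → d y ≤ N → (G.Adj x y ↔ H.Adj x y) := by
    intro x y hx hy
    simp only [G, H, ascendingGraph_adj, E, E']
    simp only [d] at hx hy
    omega
  refine ⟨G, H, 0, ascendingGraph_connected fun j hj h => ⟨j - 1, by omega, by simp only [E]; omega⟩,
    ascendingGraph_connected fun j hj h => ?_, fun h => ?_, fun k hk => ?_⟩
  · rcases eq_or_ne j (N + 2) with rfl | hj'
    · exact ⟨N, by omega, by simp [E']⟩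
    · exact ⟨j - 1, by omega, by simp only [E']; omega⟩
  · have hlow := adjMatrix_pow_congr_of_level hv hG hH hGH N le_rfl
    have hzero := adjMatrix_pow_eq_zero_of_level hv hH N
    have hdiff := adjMatrix_pow_self_sub_of_level hv hG hH hGH
    rw [← closedWalkCount_eq_adjMatrix_pow, ← closedWalkCount_eq_adjMatrix_pow, h, sub_self] at hdiff
    let a : Fin (N + 3) := ⟨N, by omega⟩
    let p : Fin (N + 3) := ⟨N + 1, by omega⟩
    let q : Fin (N + 3) := ⟨N + 2, by omega⟩
    have hfilter : Finset.univ.filter (fun x => N < d x) = {p, q} := by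
      ext x
      simp only [Finset.mem_filter, Finset.mem_univ, true_and, Finset.mem_insert,
        Finset.mem_singleton, d, p, q, Fin.ext_iff]
      omega
    have hpq : p ≠ q := by simp [p, q]
    have hp : (G.adjMatrix ℤ ^ (N + 1)) 0 p = (H.adjMatrix ℤ ^ (N + 1)) 0 p := by
      rw [adjMatrix_pow_succ_apply, adjMatrix_pow_succ_apply]
      refine Finset.sum_congr rfl fun y _ => ?_
      rw [hlow]
      by_cases hy : N < d y
      · rw [hzero y hy]; simp
      · have : G.Adj y p ↔ H.Adj y p := by
          simp only [G, H, ascendingGraph_adj, E, E', p]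
          simp only [d] at hy
          omega
        simp only [this]
    have hGq : (G.adjMatrix ℤ ^ (N + 1)) 0 q = 0 := by
      rw [adjMatrix_pow_succ_apply]
      refine Finset.sum_eq_zero fun y _ => ?_
      rw [hlow]
      by_cases hy : N < d y
      · rw [hzero y hy]; simp
      · rw [if_neg]
        simp only [G, ascendingGraph_adj, E, q]
        simp only [d] at hy
        omega
    have hHq : (H.adjMatrix ℤ ^ (N + 1)) 0 q = (H.adjMatrix ℤ ^ N) 0 a := by
      rw [adjMatrix_pow_succ_apply, Finset.sum_eq_single a]
      · rw [if_pos]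
        simp [H, ascendingGraph_adj, E', q, a]
      · intro y _ hy
        rw [if_neg]
        simp only [a, ne_eq, Fin.ext_iff] at hy
        simp only [H, ascendingGraph_adj, E', q]
        omega
      · simp
    have hpos : 0 < (G.adjMatrix ℤ ^ N) 0 a := by
      obtain ⟨w, hw⟩ := ascendingGraph_exists_walk (n := N + 3) (E := E) id rfl (b := N) (by omega)
        (fun j _ h => ⟨j - 1, by omega, by simp only [E]; omega, by simp only [id]; omega⟩) N le_rfl
      have := adjMatrix_pow_pos_of_walk w
      rwa [hw] at this
    -- Only `q` contributes to the difference: minus the square of the number of walks of length N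
    -- to `a`.
    rw [hfilter, Finset.sum_pair hpq, hp, hGq, hHq, ← hlow] at hdiff
    have := pow_pos hpos 2
    linarith
  · have := adjMatrix_pow_self_congr_of_level hv hG hH hGH k (by omega)
    rw [← closedWalkCount_eq_adjMatrix_pow, ← closedWalkCount_eq_adjMatrix_pow] at this
    exact_mod_cast this

theorem closedWalkCount_two {V : Type*} [Fintype V] (G : SimpleGraph V) [DecidableRel G.Adj] (v : V) :
    closedWalkCount G v 2 = G.degree v := by
  classical
  zify
  rw [closedWalkCount_eq_adjMatrix_pow, pow_two, SimpleGraph.adjMatrix_mul_self_apply_self]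

theorem walkCount_one {V : Type*} [Fintype V] (G : SimpleGraph V) [DecidableRel G.Adj] (v : V) :
    walkCount G v 1 = G.degree v := by
  classical
  zify
  rw [walkCount_eq_sum_adjMatrix_pow, pow_one]
  simp [SimpleGraph.adjMatrix_apply, ← SimpleGraph.card_neighborFinset_eq_degree,
    SimpleGraph.neighborFinset_eq_filter]

/-! ### The chain of hexagons and its profile. -/

/-- The number of walks of length `k` starting at position `i` of the bi-infinite chain in which
hexagons at the positions congruent to `1, ..., 6` modulo `B` are joined by paths. -/
def chainProfile (B : ℕ) : ℕ → ℤ → ℤ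
  | 0, _ => 1
  | k + 1, i =>
    (if i % B = 3 ∨ i % B = 4 ∨ i % B = 5 then 0 else chainProfile B k (i - 1)) +
    (if i % B = 2 ∨ i % B = 3 ∨ i % B = 4 then 0 else chainProfile B k (i + 1)) +
    (if i % B = 3 ∨ i % B = 4 ∨ i % B = 5 ∨ i % B = 6 then chainProfile B k (i - 2) else 0) +
    (if i % B = 1 ∨ i % B = 2 ∨ i % B = 3 ∨ i % B = 4 then chainProfile B k (i + 2) else 0)

theorem chainProfile_add_period (B k : ℕ) (i : ℤ) :
    chainProfile B k (i + B) = chainProfile B k i := by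
  induction k generalizing i with
  | zero => rfl
  | succ k ih =>
    simp only [chainProfile, Int.add_emod_right]
    rw [show i + B - 1 = i - 1 + B by ring, show i + B + 1 = i + 1 + B by ring,
      show i + B - 2 = i - 2 + B by ring, show i + B + 2 = i + 2 + B by ring, ih, ih, ih, ih]

theorem chainProfile_add_mul_period (B k q : ℕ) (i : ℤ) :
    chainProfile B k (i + q * B) = chainProfile B k i := by
  induction q with
  | zero => simp
  | succ q ih =>
    rw [← ih, ← chainProfile_add_period B k (i + q * B)]
    congr 1
    push_cast
    ring

theorem chainProfile_mirror {B : ℕ} (hB : 7 ≤ B) (k : ℕ) (i : ℤ) :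
    chainProfile B k (7 - i) = chainProfile B k i := by
  induction k generalizing i with
  | zero => rfl
  | succ k ih =>
    -- Reflection in the centre of a hexagon is an automorphism of the bi-infinite chain; it
    -- exchanges the residues 1 and 6, 2 and 5, 3 and 4.
    have h : ∀ c : ℤ, 1 ≤ c → c ≤ 6 → ((7 - i) % B = 7 - c ↔ i % B = c) := by
      intro c h1 h2
      have key (j e : ℤ) (he : 0 ≤ e) (he' : e < B) : j % B = e ↔ (B : ℤ) ∣ j - e := by
        conv_lhs => rw [← Int.emod_eq_of_lt he he']
        exact Int.emod_eq_emod_iff_emod_sub_eq_zero.trans Int.dvd_iff_emod_eq_zero.symm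
      rw [key _ _ (by omega) (by omega), key _ _ (by omega) (by omega), ← dvd_neg]
      ring_nf
    have h1 := h 1 (by norm_num) (by norm_num)
    have h2 := h 2 (by norm_num) (by norm_num)
    have h3 := h 3 (by norm_num) (by norm_num)
    have h4 := h 4 (by norm_num) (by norm_num)
    have h5 := h 5 (by norm_num) (by norm_num)
    have h6 := h 6 (by norm_num) (by norm_num)
    norm_num at h1 h2 h3 h4 h5 h6
    have a1 : chainProfile B k (7 - i - 1) = chainProfile B k (i + 1) := by
      rw [← ih (i + 1), sub_sub, add_comm]
    have a2 : chainProfile B k (7 - i + 1) = chainProfile B k (i - 1) := by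
      rw [← ih (i - 1), sub_add]
    have a3 : chainProfile B k (7 - i - 2) = chainProfile B k (i + 2) := by
      rw [← ih (i + 2), sub_sub, add_comm]
    have a4 : chainProfile B k (7 - i + 2) = chainProfile B k (i - 2) := by
      rw [← ih (i - 2), sub_add]
    simp only [chainProfile, h1, h2, h3, h4, h5, h6]
    have e1 : (i % B = 5 ∨ i % B = 4 ∨ i % B = 3) ↔ (i % B = 3 ∨ i % B = 4 ∨ i % B = 5) := by omega
    have e2 : (i % B = 4 ∨ i % B = 3 ∨ i % B = 2) ↔ (i % B = 2 ∨ i % B = 3 ∨ i % B = 4) := by omega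
    have e3 : (i % B = 4 ∨ i % B = 3 ∨ i % B = 2 ∨ i % B = 1) ↔
      (i % B = 1 ∨ i % B = 2 ∨ i % B = 3 ∨ i % B = 4) := by omega
    have e4 : (i % B = 6 ∨ i % B = 3 ∨ i % B = 4 ∨ i % B = 5) ↔
      (i % B = 3 ∨ i % B = 4 ∨ i % B = 5 ∨ i % B = 6) := by omega
    simp only [a1, a2, a3, a4, e1, e2, e3, e4]
    ring

/-- Edges of the finite chain of hexagons that ends with a triangle at the positions
`M + 1, M + 2, M + 3`, with further leaves attached at position `0`. -/
def chainEdge (B M i j : ℕ) : Prop :=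
  (j ≤ M + 3 ∧ ((j = i + 1 ∧ (i % B < 2 ∨ 4 < i % B)) ∨ (j = i + 2 ∧ 1 ≤ i % B ∧ i % B ≤ 4))) ∨
    (i = M + 2 ∧ j = M + 3) ∨ (i = 0 ∧ M + 4 ≤ j)

/-- Edges of the graph obtained by switching two edges at the end of the chain. -/
def switchedChainEdge (B N i j : ℕ) : Prop :=
  (chainEdge B (N + B) i j ∧ ¬ (i = N + 5 ∧ j = N + 6) ∧ ¬ (i = N + B + 1 ∧ j = N + B + 2)) ∨
    (i = N + 5 ∧ j = N + B + 1) ∨ (i = N + 6 ∧ j = N + B + 2)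

/-- The distance from position `0` in the chain. -/
def chainLevel (B : ℕ) : ℕ → ℕ
  | 0 => 0
  | i + 1 => chainLevel B i + if i % B = 2 ∨ i % B = 4 then 0 else 1

theorem mod_succ_cases {B : ℕ} (hB : 0 < B) (i : ℕ) :
    (i % B + 1 < B ∧ (i + 1) % B = i % B + 1) ∨ (i % B + 1 = B ∧ (i + 1) % B = 0) := by
  rcases Nat.lt_or_ge (i % B + 1) B with h | h
  · left; refine ⟨h, ?_⟩
    rw [Nat.add_mod, Nat.mod_eq_of_lt (show 1 < B by omega), Nat.mod_eq_of_lt h]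
  · right
    have := Nat.mod_lt i hB
    have h' : i % B + 1 = B := by omega
    refine ⟨h', ?_⟩
    rw [← Nat.mod_add_mod, h', Nat.mod_self]

/-- The excluded edge is the base of the final triangle, whose ends have equal level. -/
theorem chainLevel_of_edge {B M i j : ℕ} (hB : 7 ≤ B) (h : chainEdge B M i j)
    (hj : j ≤ M + 3) (h' : ¬ (i = M + 2 ∧ j = M + 3)) :
    chainLevel B j = chainLevel B i + 1 := by
  have h1 := mod_succ_cases (B := B) (by omega) i
  rcases h with ⟨-, ⟨rfl, h⟩ | ⟨rfl, h⟩⟩ | h | h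
  · rw [chainLevel, if_neg (by omega)]
  · rw [chainLevel, chainLevel]
    split_ifs <;> omega
  · exact absurd h h'
  · omega

/-- The chosen parents avoid the triangle base and all edges between residues 5 and 6. They thus
give walks rising one level per step, and all but one of them survive the switch. -/
theorem chainEdge_pred {B M j : ℕ} (hB : 7 ≤ B) (hM : M % B = 0) (hpos : 0 < j) (hj : j ≤ M + 3) :
    ∃ i < j, chainEdge B M i j ∧ ¬ (i = M + 2 ∧ j = M + 3) ∧ ¬ (i % B = 5 ∧ j % B = 6) := by
  obtain ⟨i, rfl⟩ : ∃ i, j = i + 1 := ⟨j - 1, by omega⟩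
  have h1 := mod_succ_cases (B := B) (by omega) i
  by_cases hi : i % B < 2 ∨ 5 < i % B
  · exact ⟨i, by omega, Or.inl ⟨hj, Or.inl ⟨rfl, by omega⟩⟩, by
      rintro ⟨rfl, -⟩
      have h2 := mod_succ_cases (B := B) (by omega) M
      have h3 := mod_succ_cases (B := B) (by omega) (M + 1)
      rw [show M + 1 + 1 = M + 2 from rfl] at h3
      omega, by omega⟩
  · obtain ⟨l, rfl⟩ : ∃ l, i = l + 1 := by
      refine ⟨i - 1, ?_⟩
      have : i ≠ 0 := by rintro rfl; simp at hi
      omega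
    have h2 := mod_succ_cases (B := B) (by omega) l
    exact ⟨l, by omega, Or.inl ⟨hj, Or.inr ⟨rfl, by omega⟩⟩, by omega, by omega⟩

/-- The extension of the chain profile to the leaves attached at position `0`. -/
def leafedProfile (B M k x : ℕ) : ℤ :=
  if x ≤ M + 3 then chainProfile B k x else
    match k with
    | 0 => 1
    | k + 1 => chainProfile B k 0

theorem leafedProfile_of_le {B M k x : ℕ} (hx : x ≤ M + 3) :
    leafedProfile B M k x = chainProfile B k x := if_pos hx

theorem ascendingGraph_sum_adj {n : ℕ} {E : ℕ → ℕ → Prop} [DecidableRel (ascendingGraph n E).Adj]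
    (x : Fin n) (φ : ℕ → ℤ) (S : Finset ℕ)
    (hS : ∀ y < n, ((x.val < y ∧ E x y) ∨ (y < x.val ∧ E y x)) ↔ y ∈ S) (hn : ∀ y ∈ S, y < n) :
    (∑ y : Fin n, if (ascendingGraph n E).Adj x y then φ y else 0) = ∑ y ∈ S, φ y := by
  classical
  have h1 : (∑ y : Fin n, if (ascendingGraph n E).Adj x y then φ y else 0) =
      ∑ y : Fin n, if y.val ∈ S then φ y else 0 :=
    Finset.sum_congr rfl fun y _ => by simp only [ascendingGraph_adj, hS y y.2]
  rw [h1, Fin.sum_univ_eq_sum_range (fun y => if y ∈ S then φ y else 0) n, ← Finset.sum_filter]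
  congr 1
  ext y
  simp only [Finset.mem_filter, Finset.mem_range]
  exact ⟨fun h => h.2, fun h => ⟨hn y h, h⟩⟩

theorem chainProfile_succ_natCast (B k x : ℕ) :
    chainProfile B (k + 1) x =
    (if x % B = 3 ∨ x % B = 4 ∨ x % B = 5 then 0 else chainProfile B k (x - 1)) +
    (if x % B = 2 ∨ x % B = 3 ∨ x % B = 4 then 0 else chainProfile B k (x + 1)) +
    (if x % B = 3 ∨ x % B = 4 ∨ x % B = 5 ∨ x % B = 6 then chainProfile B k (x - 2) else 0) +
    (if x % B = 1 ∨ x % B = 2 ∨ x % B = 3 ∨ x % B = 4 then chainProfile B k (x + 2) else 0) := by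
  have h (c : ℕ) : (x : ℤ) % B = c ↔ x % B = c := by norm_cast
  have h1 := h 1
  have h2 := h 2
  have h3 := h 3
  have h4 := h 4
  have h5 := h 5
  have h6 := h 6
  push_cast at h1 h2 h3 h4 h5 h6
  simp only [chainProfile, h1, h2, h3, h4, h5, h6]

section

variable {B M s : ℕ}

theorem leafedProfile_zero (x : ℕ) : leafedProfile B M 0 x = 1 := by
  unfold leafedProfile
  split_ifs <;> rfl

theorem mod_add_of_mod_eq_zero {c : ℕ} (hM : M % B = 0) (hc : c < B) : (M + c) % B = c := by
  rw [Nat.add_mod, hM, zero_add, Nat.mod_mod, Nat.mod_eq_of_lt hc]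

theorem chainProfile_add_of_mod_eq_zero {k : ℕ} (hM : M % B = 0) (c : ℤ) :
    chainProfile B k ((M : ℤ) + c) = chainProfile B k c := by
  obtain ⟨q, rfl⟩ := Nat.dvd_of_mod_eq_zero hM
  rw [← chainProfile_add_mul_period B k q c]
  congr 1
  push_cast
  ring

theorem chainEdge_iff_le_succ {x y : ℕ} (hx : x ≤ M + 1) (h : 0 < x) :
    chainEdge B M x y ↔
      (y = x + 1 ∧ (x % B < 2 ∨ 4 < x % B)) ∨ (y = x + 2 ∧ 1 ≤ x % B ∧ x % B ≤ 4) := by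
  unfold chainEdge
  omega

/-- In this range the finite chain has the neighbourhoods of the bi-infinite one; they are listed
residue by residue. -/
theorem leafedProfile_succ_of_le (hB : 7 ≤ B) (hM : M % B = 0)
    [DecidableRel (ascendingGraph (M + 4 + s) (chainEdge B M)).Adj] (k : ℕ)
    (x : Fin (M + 4 + s)) (h0 : 0 < x.val) (hx : x.val ≤ M + 1) :
    (∑ y : Fin (M + 4 + s),
      if (ascendingGraph (M + 4 + s) (chainEdge B M)).Adj x y then leafedProfile B M k y else 0) =
      leafedProfile B M (k + 1) x := by
  obtain ⟨x, hxn⟩ := x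
  simp only at h0 hx
  obtain ⟨z, rfl⟩ : ∃ z, x = z + 1 := ⟨x - 1, by omega⟩
  have hz := mod_succ_cases (B := B) (by omega) z
  have hM1 := mod_add_of_mod_eq_zero hM (show 1 < B by omega)
  have hz0 : z = 0 → z % B = 0 := by rintro rfl; simp
  have hw : ∀ w, z = w + 1 → (w % B + 1 < B ∧ z % B = w % B + 1) ∨ (w % B + 1 = B ∧ z % B = 0) := by
    rintro w rfl
    exact mod_succ_cases (by omega) w
  have hxM : z + 1 = M + 1 → (z + 1) % B = 1 := by intro h; rw [h, hM1]
  have hxM' : (z + 1) % B ≠ 1 → z + 1 ≤ M := by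
    intro h
    by_contra hc
    exact h (hxM (by omega))
  rw [leafedProfile_of_le (by simp only; omega)]
  simp only
  rw [chainProfile_succ_natCast]
  have key (S : Finset ℕ) (hS : ∀ y, y ∈ S ↔
      (y = z + 2 ∧ ((z + 1) % B < 2 ∨ 4 < (z + 1) % B)) ∨
        (y = z + 3 ∧ 1 ≤ (z + 1) % B ∧ (z + 1) % B ≤ 4) ∨
        (y = z ∧ ((z + 1) % B < 3 ∨ 5 < (z + 1) % B)) ∨
        (z = y + 1 ∧ 3 ≤ (z + 1) % B ∧ (z + 1) % B ≤ 6)) :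
      (∑ y : Fin (M + 4 + s), if (ascendingGraph (M + 4 + s) (chainEdge B M)).Adj ⟨z + 1, hxn⟩ y
        then leafedProfile B M k y else 0) = ∑ y ∈ S, chainProfile B k y := by
    rw [ascendingGraph_sum_adj _ _ S]
    · refine Finset.sum_congr rfl fun y hy => leafedProfile_of_le ?_
      rw [hS] at hy
      omega
    · intro y hy
      rw [hS, chainEdge_iff_le_succ (by simp only; omega) (by simp only; omega)]
      have h1 := hw y
      have h2 : y = z → y % B = z % B := fun h => by rw [h]
      unfold chainEdge
      simp only
      omega
    · intro y hy
      rw [hS] at hy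
      omega
  have hsub1 : (((z + 1 : ℕ) : ℤ) - 1) = (z : ℕ) := by push_cast; ring
  have hadd1 : (((z + 1 : ℕ) : ℤ) + 1) = (z + 2 : ℕ) := by push_cast; ring
  have hadd2 : (((z + 1 : ℕ) : ℤ) + 2) = (z + 3 : ℕ) := by push_cast; ring
  rw [hsub1, hadd1, hadd2]
  rcases Nat.lt_or_ge ((z + 1) % B) 3 with hr | hr
  · rw [if_neg (by omega), if_neg (c := _ ∨ _ ∨ _ ∨ (z + 1) % B = 6) (by omega)]
    obtain hr | hr | hr : (z + 1) % B = 0 ∨ (z + 1) % B = 1 ∨ (z + 1) % B = 2 := by omega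
    · rw [key {z, z + 2} (by simp [hr]; omega), Finset.sum_pair (by omega), if_neg (by omega),
        if_neg (by omega)]
      ring
    · rw [key {z, z + 2, z + 3} (by simp [hr]; omega), Finset.sum_insert (by simp),
        Finset.sum_pair (by omega), if_neg (by omega), if_pos (by omega)]
      ring
    · rw [key {z, z + 3} (by simp [hr]; omega), Finset.sum_pair (by omega), if_pos (by omega),
        if_pos (by omega)]
      ring
  · obtain ⟨w, rfl⟩ : ∃ w, z = w + 1 := ⟨z - 1, by omega⟩
    have hsub2 : (((w + 1 + 1 : ℕ) : ℤ) - 2) = (w : ℕ) := by push_cast; ring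
    rw [hsub2]
    by_cases hr7 : (w + 1 + 1) % B < 7
    · obtain hr | hr | hr | hr : (w + 1 + 1) % B = 3 ∨ (w + 1 + 1) % B = 4 ∨ (w + 1 + 1) % B = 5 ∨
        (w + 1 + 1) % B = 6 := by omega
      · rw [key {w, w + 1 + 3} (by simp [hr]; omega), Finset.sum_pair (by omega)]
        simp [hr]
      · rw [key {w, w + 1 + 3} (by simp [hr]; omega), Finset.sum_pair (by omega)]
        simp [hr]
      · rw [key {w, w + 1 + 2} (by simp [hr]; omega), Finset.sum_pair (by omega)]
        simp [hr]
        ring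
      · rw [key {w, w + 1, w + 1 + 2} (by simp [hr]; omega), Finset.sum_insert (by simp; omega),
          Finset.sum_pair (by omega)]
        simp [hr]
        ring
    · rw [key {w + 1, w + 1 + 2} (by intro y; simp; omega), Finset.sum_pair (by omega),
        if_neg (by omega), if_neg (by omega), if_neg (by omega), if_neg (by omega)]
      ring

/-- The chain with leaves attached satisfies the profile recursion away from position `0`. -/
theorem leafedProfile_succ (hB : 7 ≤ B) (hM : M % B = 0)
    [DecidableRel (ascendingGraph (M + 4 + s) (chainEdge B M)).Adj] (k : ℕ)
    (x : Fin (M + 4 + s)) (h0 : 0 < x.val) :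
    (∑ y : Fin (M + 4 + s),
      if (ascendingGraph (M + 4 + s) (chainEdge B M)).Adj x y then leafedProfile B M k y else 0) =
      leafedProfile B M (k + 1) x := by
  rcases Nat.lt_or_ge (M + 1) x with hx | hx
  swap
  · exact leafedProfile_succ_of_le hB hM k x h0 hx
  have hM1 := mod_add_of_mod_eq_zero hM (show 1 < B by omega)
  have hM2 := mod_add_of_mod_eq_zero hM (show 2 < B by omega)
  have hM3 := mod_add_of_mod_eq_zero hM (show 3 < B by omega)
  have hmir := chainProfile_mirror hB
  have hper := fun k => chainProfile_add_of_mod_eq_zero (k := k) hM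
  have hMM (c : ℕ) : ∀ y, y = M + c → y % B = (M + c) % B := fun y h => by rw [h]
  have hMM0 := hMM 0
  have hMM1 := hMM 1
  have hMM2 := hMM 2
  rw [Nat.add_zero] at hMM0
  obtain ⟨x, hxn⟩ := x
  simp only at h0 hx
  obtain rfl | rfl | hx : x = M + 2 ∨ x = M + 3 ∨ M + 4 ≤ x := by omega
  · rw [ascendingGraph_sum_adj _ _ {M + 1, M + 3}, Finset.sum_pair (by omega),
      leafedProfile_of_le (by omega), leafedProfile_of_le (by omega),
      leafedProfile_of_le (by simp only; omega)]
    · simp only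
      rw [chainProfile_succ_natCast, hM2]
      -- In the triangle, M + 3 stands in for the missing neighbour M + 4, its mirror image.
      have h34 : chainProfile B k ((M + 3 : ℕ) : ℤ) = chainProfile B k ((M + 2 : ℕ) + 2) := by
        push_cast
        rw [add_assoc, hper, hper, ← hmir]
        norm_num
      rw [h34]
      norm_num
      congr 1
      ring
    · intro y hy
      have := hMM0 y
      have := hMM1 y
      simp only [chainEdge, hM2, true_and, Finset.mem_insert, Finset.mem_singleton]
      omega
    · intro y hy
      simp only [Finset.mem_insert, Finset.mem_singleton] at hy
      omega
  · rw [ascendingGraph_sum_adj _ _ {M + 1, M + 2}, Finset.sum_pair (by omega),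
      leafedProfile_of_le (by omega), leafedProfile_of_le (by omega),
      leafedProfile_of_le (by simp only; omega)]
    · simp only
      rw [chainProfile_succ_natCast, hM3]
      -- Likewise M + 2 stands in for M + 5.
      have h25 : chainProfile B k ((M + 2 : ℕ) : ℤ) = chainProfile B k ((M + 3 : ℕ) + 2) := by
        push_cast
        rw [add_assoc, hper, hper, ← hmir]
        norm_num
      rw [h25]
      norm_num
      congr 1
      ring
    · intro y hy
      have := hMM0 y
      have := hMM1 y
      have := hMM2 y
      simp only [chainEdge, hM3, and_true, Finset.mem_insert, Finset.mem_singleton]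
      omega
    · intro y hy
      simp only [Finset.mem_insert, Finset.mem_singleton] at hy
      omega
  · rw [ascendingGraph_sum_adj _ _ {0}, Finset.sum_singleton, leafedProfile_of_le (by omega)]
    · simp only [leafedProfile]
      rw [if_neg (by omega)]
      simp
    · intro y hy
      simp only [chainEdge, Finset.mem_singleton]
      omega
    · intro y hy
      simp only [Finset.mem_singleton] at hy
      omega

end

/-! ### Switching two edges without changing the profile. -/

theorem adjMatrix_pow_succ_apply_of_level {V : Type*} [Fintype V] [DecidableEq V]
    {G : SimpleGraph V} [DecidableRel G.Adj] {v : V} {d : V → ℕ} {R : ℕ} (hv : d v = 0)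
    (hG : ∀ x y, G.Adj x y → d y ≤ d x + 1) (x : V) (S : Finset V)
    (hS : ∀ y, d y ≤ R → (G.Adj y x ↔ y ∈ S)) :
    (G.adjMatrix ℤ ^ (R + 1)) v x = ∑ y ∈ S, (G.adjMatrix ℤ ^ R) v y := by
  have h : ∑ y ∈ S, (G.adjMatrix ℤ ^ R) v y = ∑ y, if y ∈ S then (G.adjMatrix ℤ ^ R) v y else 0 := by
    simp
  rw [adjMatrix_pow_succ_apply, h]
  refine Finset.sum_congr rfl fun y _ => ?_
  by_cases hy : d y ≤ R
  · simp only [hS y hy]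
  · rw [adjMatrix_pow_eq_zero_of_level hv hG R y (by omega)]
    simp

theorem sum_adj_eq_of_replace {V : Type*} [Fintype V] [DecidableEq V] {G H : SimpleGraph V}
    [DecidableRel G.Adj] [DecidableRel H.Adj] (φ : V → ℤ) {x t t' : V} (ht : G.Adj x t)
    (ht' : ¬ G.Adj x t') (h : ∀ y, H.Adj x y ↔ (G.Adj x y ∧ y ≠ t) ∨ y = t') (hφ : φ t = φ t') :
    (∑ y, if H.Adj x y then φ y else 0) = ∑ y, if G.Adj x y then φ y else 0 := by
  rw [← Finset.sum_filter, ← Finset.sum_filter]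
  have h1 : Finset.univ.filter (fun y => H.Adj x y) =
      insert t' ((Finset.univ.filter (fun y => G.Adj x y)).erase t) := by
    ext y
    simp only [Finset.mem_filter, Finset.mem_univ, true_and, Finset.mem_insert, Finset.mem_erase, h]
    tauto
  rw [h1, Finset.sum_insert (by simp [ht']),
    ← Finset.add_sum_erase (Finset.univ.filter (fun y => G.Adj x y)) φ (a := t) (by simp [ht]), hφ]

section

variable {B N s : ℕ}

theorem switchedChain_adj (x y : Fin (N + B + 4 + s)) :
    (ascendingGraph (N + B + 4 + s) (switchedChainEdge B N)).Adj x y ↔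
      ((ascendingGraph (N + B + 4 + s) (chainEdge B (N + B))).Adj x y ∧
        ¬ ((x.val = N + 5 ∧ y.val = N + 6) ∨ (x.val = N + 6 ∧ y.val = N + 5) ∨
          (x.val = N + B + 1 ∧ y.val = N + B + 2) ∨ (x.val = N + B + 2 ∧ y.val = N + B + 1))) ∨
      (x.val = N + 5 ∧ y.val = N + B + 1 ∧ N + 5 < N + B + 1) ∨
      (x.val = N + B + 1 ∧ y.val = N + 5 ∧ N + 5 < N + B + 1) ∨
      (x.val = N + 6 ∧ y.val = N + B + 2 ∧ N + 6 < N + B + 2) ∨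
      (x.val = N + B + 2 ∧ y.val = N + 6 ∧ N + 6 < N + B + 2) := by
  simp only [ascendingGraph_adj, switchedChainEdge]
  rcases lt_trichotomy x.val y.val with h | h | h
  · by_cases h1 : chainEdge B (N + B) x y <;>
      simp only [h, h.le.not_gt, h1, true_and, false_and, false_or, or_false] <;>
      omega
  · simp only [h, lt_irrefl, false_and, or_self, false_or, false_iff]
    omega
  · by_cases h1 : chainEdge B (N + B) y x <;>
      simp only [h, h.le.not_gt, h1, true_and, false_and, false_or, or_false] <;>
      omega

theorem switchedChain_adj_of_ne (x y : Fin (N + B + 4 + s)) (h1 : x.val ≠ N + 5)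
    (h2 : x.val ≠ N + 6) (h3 : x.val ≠ N + B + 1) (h4 : x.val ≠ N + B + 2) :
    (ascendingGraph (N + B + 4 + s) (switchedChainEdge B N)).Adj x y ↔
      (ascendingGraph (N + B + 4 + s) (chainEdge B (N + B))).Adj x y := by
  simp [switchedChain_adj, h1, h2, h3, h4]

/-- Each of the four affected vertices loses one neighbour and gains another of equal profile: N + 5
and N + B + 2 have mirror residues 5 and 2, and N + 6 and N + B + 1 have 6 and 1. -/
theorem sum_adj_switchedChain (hB : 7 ≤ B) (hN : N % B = 0)
    [DecidableRel (ascendingGraph (N + B + 4 + s) (chainEdge B (N + B))).Adj]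
    [DecidableRel (ascendingGraph (N + B + 4 + s) (switchedChainEdge B N)).Adj] (k : ℕ)
    (x : Fin (N + B + 4 + s)) :
    (∑ y : Fin (N + B + 4 + s), if (ascendingGraph (N + B + 4 + s) (switchedChainEdge B N)).Adj x y
      then leafedProfile B (N + B) k y else 0) =
    ∑ y : Fin (N + B + 4 + s), if (ascendingGraph (N + B + 4 + s) (chainEdge B (N + B))).Adj x y
      then leafedProfile B (N + B) k y else 0 := by
  have hM : (N + B) % B = 0 := by rw [Nat.add_mod_right, hN]
  have hN5 := mod_add_of_mod_eq_zero (c := 5) hN (by omega)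
  have hN6 := mod_add_of_mod_eq_zero (c := 6) hN (by omega)
  have hM1 := mod_add_of_mod_eq_zero (c := 1) hM (by omega)
  have hM2 := mod_add_of_mod_eq_zero (c := 2) hM (by omega)
  have h52 : leafedProfile B (N + B) k (N + 5) = leafedProfile B (N + B) k (N + B + 2) := by
    rw [leafedProfile_of_le (by omega), leafedProfile_of_le (by omega)]
    have h1 := chainProfile_add_of_mod_eq_zero (k := k) hN 5
    have h2 := chainProfile_add_of_mod_eq_zero (k := k) hM 2
    have h3 := chainProfile_mirror hB k 2
    push_cast at h1 h2 ⊢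
    rw [h1, h2, ← h3]
    norm_num
  have h61 : leafedProfile B (N + B) k (N + 6) = leafedProfile B (N + B) k (N + B + 1) := by
    rw [leafedProfile_of_le (by omega), leafedProfile_of_le (by omega)]
    have h1 := chainProfile_add_of_mod_eq_zero (k := k) hN 6
    have h2 := chainProfile_add_of_mod_eq_zero (k := k) hM 1
    have h3 := chainProfile_mirror hB k 1
    push_cast at h1 h2 ⊢
    rw [h1, h2, ← h3]
    norm_num
  obtain ⟨b, hb⟩ : ∃ b : Fin (N + B + 4 + s), b.val = N + 5 := ⟨⟨N + 5, by omega⟩, rfl⟩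
  obtain ⟨p, hp⟩ : ∃ p : Fin (N + B + 4 + s), p.val = N + 6 := ⟨⟨N + 6, by omega⟩, rfl⟩
  obtain ⟨q, hq⟩ : ∃ q : Fin (N + B + 4 + s), q.val = N + B + 1 := ⟨⟨N + B + 1, by omega⟩, rfl⟩
  obtain ⟨c, hc⟩ : ∃ c : Fin (N + B + 4 + s), c.val = N + B + 2 := ⟨⟨N + B + 2, by omega⟩, rfl⟩
  by_cases h1 : x = b
  · subst h1
    refine sum_adj_eq_of_replace (fun y : Fin (N + B + 4 + s) => leafedProfile B (N + B) k y) (t := p) (t' := q)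
      ?_ ?_ (fun y => ?_) (by simp only [hp, hq, h61])
    · rw [ascendingGraph_adj, hb, hp]
      unfold chainEdge
      omega
    · rw [ascendingGraph_adj, hb, hq]
      unfold chainEdge
      omega
    · rw [switchedChain_adj, ne_eq, Fin.ext_iff, Fin.ext_iff]
      by_cases hg : (ascendingGraph (N + B + 4 + s) (chainEdge B (N + B))).Adj x y <;>
        simp only [hg, true_and, false_and, false_or] <;> omega
  by_cases h2 : x = p
  · subst h2
    refine sum_adj_eq_of_replace (fun y : Fin (N + B + 4 + s) => leafedProfile B (N + B) k y) (t := b) (t' := c)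
      ?_ ?_ (fun y => ?_) (by simp only [hb, hc, h52])
    · rw [ascendingGraph_adj, hp, hb]
      unfold chainEdge
      omega
    · rw [ascendingGraph_adj, hp, hc]
      unfold chainEdge
      omega
    · rw [switchedChain_adj, ne_eq, Fin.ext_iff, Fin.ext_iff]
      by_cases hg : (ascendingGraph (N + B + 4 + s) (chainEdge B (N + B))).Adj x y <;>
        simp only [hg, true_and, false_and, false_or] <;> omega
  by_cases h3 : x = q
  · subst h3
    refine sum_adj_eq_of_replace (fun y : Fin (N + B + 4 + s) => leafedProfile B (N + B) k y) (t := c) (t' := b)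
      ?_ ?_ (fun y => ?_) (by simp only [hc, hb, h52])
    · rw [ascendingGraph_adj, hq, hc]
      unfold chainEdge
      omega
    · rw [ascendingGraph_adj, hq, hb]
      unfold chainEdge
      omega
    · rw [switchedChain_adj, ne_eq, Fin.ext_iff, Fin.ext_iff]
      by_cases hg : (ascendingGraph (N + B + 4 + s) (chainEdge B (N + B))).Adj x y <;>
        simp only [hg, true_and, false_and, false_or] <;> omega
  by_cases h4 : x = c
  · subst h4
    refine sum_adj_eq_of_replace (fun y : Fin (N + B + 4 + s) => leafedProfile B (N + B) k y) (t := q) (t' := p)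
      ?_ ?_ (fun y => ?_) (by simp only [hq, hp, h61])
    · rw [ascendingGraph_adj, hc, hq]
      unfold chainEdge
      omega
    · rw [ascendingGraph_adj, hc, hp]
      unfold chainEdge
      omega
    · rw [switchedChain_adj, ne_eq, Fin.ext_iff, Fin.ext_iff]
      by_cases hg : (ascendingGraph (N + B + 4 + s) (chainEdge B (N + B))).Adj x y <;>
        simp only [hg, true_and, false_and, false_or] <;> omega
  refine Finset.sum_congr rfl fun y _ => ?_
  rw [Fin.ext_iff] at h1 h2 h3 h4
  simp only [switchedChain_adj_of_ne x y (by omega) (by omega) (by omega) (by omega)]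

/-- The difference between the profile at position `0` and the sum over its neighbours. -/
noncomputable def chainDefect (B N s k : ℕ) : ℤ := by
  classical
  exact leafedProfile B (N + B) (k + 1) 0 -
    ∑ y : Fin (N + B + 4 + s), if (ascendingGraph (N + B + 4 + s) (chainEdge B (N + B))).Adj
      ⟨0, by omega⟩ y then leafedProfile B (N + B) k y else 0

/-- Position 0 has 2 neighbours in the bi-infinite chain but 1 + s in the finite one. -/
theorem chainDefect_zero (hB : 7 ≤ B) : chainDefect B N s 0 = 1 - s := by
  classical
  have h := ascendingGraph_sum_adj (n := N + B + 4 + s) (E := chainEdge B (N + B)) ⟨0, by omega⟩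
    (leafedProfile B (N + B) 0) (insert 1 (Finset.Ico (N + B + 4) (N + B + 4 + s)))
    (by intro y hy; simp only [chainEdge, Nat.zero_mod, true_and, Finset.mem_insert, Finset.mem_Ico]
        omega)
    (by intro y hy; simp only [Finset.mem_insert, Finset.mem_Ico] at hy; omega)
  rw [Finset.sum_insert (by simp)] at h
  simp only [leafedProfile_zero, Finset.sum_const, Nat.card_Ico, add_tsub_cancel_left,
    nsmul_eq_mul, mul_one] at h
  simp only [chainDefect, leafedProfile_zero]
  rw [leafedProfile_of_le (by omega)]
  have h2 : chainProfile B (0 + 1) ((0 : ℕ) : ℤ) = 2 := by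
    rw [chainProfile_succ_natCast]
    simp [chainProfile]
  rw [h2]
  convert (congrArg (fun t : ℤ => 2 - t) h) using 1
  ring

theorem leafedProfile_succ_chain (hB : 7 ≤ B) (hN : N % B = 0)
    [DecidableRel (ascendingGraph (N + B + 4 + s) (chainEdge B (N + B))).Adj] (k : ℕ)
    (x : Fin (N + B + 4 + s)) :
    leafedProfile B (N + B) (k + 1) x =
      (∑ y : Fin (N + B + 4 + s), if (ascendingGraph (N + B + 4 + s) (chainEdge B (N + B))).Adj x y
        then leafedProfile B (N + B) k y else 0) +
      if x = ⟨0, by omega⟩ then chainDefect B N s k else 0 := by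
  have hM : (N + B) % B = 0 := by rw [Nat.add_mod_right, hN]
  split_ifs with h
  · subst h
    rw [chainDefect]
    convert (add_sub_cancel _ _).symm
  · rw [leafedProfile_succ hB hM k x, add_zero]
    simp only [Fin.ext_iff] at h
    omega

end

/-! ### Levels in the chain and the first differing closed-walk count. -/

theorem chainLevel_mono (B : ℕ) : Monotone (chainLevel B) :=
  monotone_nat_of_le_succ fun i => by simp [chainLevel]

section

variable {B N s : ℕ}

theorem chainLevel_add_of_le (hB : 7 ≤ B) (hN : N % B = 0) :
    chainLevel B (N + 1) = chainLevel B N + 1 ∧ chainLevel B (N + 2) = chainLevel B N + 2 ∧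
    chainLevel B (N + 3) = chainLevel B N + 2 ∧ chainLevel B (N + 4) = chainLevel B N + 3 ∧
    chainLevel B (N + 5) = chainLevel B N + 3 ∧ chainLevel B (N + 6) = chainLevel B N + 4 ∧
    chainLevel B (N + 7) = chainLevel B N + 5 := by
  have h (c : ℕ) (hc : c < 7) := mod_add_of_mod_eq_zero (c := c) hN (show c < B by omega)
  simp [chainLevel, hN, h]

theorem chainLevel_add_of_ge (hB : 7 ≤ B) (hN : N % B = 0) (c : ℕ) (hc : 5 ≤ c) (hcB : c ≤ B) :
    chainLevel B (N + c) + 2 = chainLevel B N + c := by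
  induction c, hc using Nat.le_induction with
  | base => rw [(chainLevel_add_of_le hB hN).2.2.2.2.1]
  | succ c hc ih =>
    have := mod_add_of_mod_eq_zero (c := c) hN (by omega)
    have := ih (by omega)
    rw [← Nat.add_assoc, chainLevel, if_neg (by omega)]
    omega

/-- Each hexagon has two pairs of positions at equal level, so a block of B positions rises by B -
2. -/
theorem chainLevel_mul (hB : 7 ≤ B) (q : ℕ) : chainLevel B (q * B) = q * (B - 2) := by
  induction q with
  | zero => simp [chainLevel]
  | succ q ih =>
    have := chainLevel_add_of_ge hB (Nat.mul_mod_left q B) B (by omega) le_rfl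
    rw [ih, ← Nat.succ_mul] at this
    rw [Nat.succ_mul q (B - 2)]
    change chainLevel B (q.succ * B) = _
    omega

/-- The distance from position `0`, truncated at the distance of position `N + 6`. -/
def truncatedLevel (B N i : ℕ) : ℕ :=
  if i ≤ N + B + 3 then min (chainLevel B i) (chainLevel B N + 4) else 1

theorem truncatedLevel_of_ge (hB : 7 ≤ B) (hN : N % B = 0) {i : ℕ} (h : N + 6 ≤ i)
    (hi : i ≤ N + B + 3) : truncatedLevel B N i = chainLevel B N + 4 := by
  have h6 := (chainLevel_add_of_le hB hN).2.2.2.2.2.1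
  have := chainLevel_mono B h
  rw [truncatedLevel, if_pos hi]
  omega

theorem truncatedLevel_lt_iff (hB : 7 ≤ B) (hN : N % B = 0) {i : ℕ} :
    chainLevel B N + 3 < truncatedLevel B N i ↔ N + 6 ≤ i ∧ i ≤ N + B + 3 := by
  constructor
  · intro h
    have h5 := (chainLevel_add_of_le hB hN).2.2.2.2.1
    by_contra hc
    unfold truncatedLevel at h
    split_ifs at h with hi
    · have := chainLevel_mono B (show i ≤ N + 5 by omega)
      omega
    · omega
  · rintro ⟨h1, h2⟩
    rw [truncatedLevel_of_ge hB hN h1 h2]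
    omega

theorem truncatedLevel_of_chainEdge (hB : 7 ≤ B) (hN : N % B = 0) {i j : ℕ}
    (h : chainEdge B (N + B) i j) :
    truncatedLevel B N j ≤ truncatedLevel B N i + 1 ∧
      truncatedLevel B N i ≤ truncatedLevel B N j + 1 := by
  by_cases hj : j ≤ N + B + 3
  · by_cases h' : i = N + B + 2 ∧ j = N + B + 3
    · rw [truncatedLevel_of_ge hB hN (by omega) hj, truncatedLevel_of_ge hB hN (by omega) (by omega)]
      omega
    · have hlev := chainLevel_of_edge hB h hj h'
      have hi : i ≤ N + B + 3 := by unfold chainEdge at h; omega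
      rw [truncatedLevel, truncatedLevel, if_pos hi, if_pos hj]
      omega
  · have hi : i = 0 := by unfold chainEdge at h; omega
    subst hi
    simp [truncatedLevel, hj, chainLevel]

/-- Truncation is what makes the new shortcut from N + 5 to N + B + 1 rise by a single level. -/
theorem truncatedLevel_of_switchedChainEdge (hB : 7 ≤ B) (hN : N % B = 0) {i j : ℕ}
    (h : switchedChainEdge B N i j) :
    truncatedLevel B N j ≤ truncatedLevel B N i + 1 ∧
      truncatedLevel B N i ≤ truncatedLevel B N j + 1 := by
  rcases h with h | ⟨rfl, rfl⟩ | ⟨rfl, rfl⟩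
  · exact truncatedLevel_of_chainEdge hB hN h.1
  · have h5 := (chainLevel_add_of_le hB hN).2.2.2.2.1
    rw [truncatedLevel_of_ge hB hN (i := N + B + 1) (by omega) (by omega), truncatedLevel,
      if_pos (by omega)]
    omega
  · rw [truncatedLevel_of_ge hB hN (i := N + B + 2) (by omega) (by omega),
      truncatedLevel_of_ge hB hN (i := N + 6) (by omega) (by omega)]
    omega

theorem chain_connected (hB : 7 ≤ B) (hN : N % B = 0) :
    (ascendingGraph (N + B + 4 + s) (chainEdge B (N + B))).Connected := by
  have hM : (N + B) % B = 0 := by rw [Nat.add_mod_right, hN]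
  have : NeZero (N + B + 4 + s) := ⟨by omega⟩
  refine ascendingGraph_connected fun j hj h0 => ?_
  by_cases hjM : j ≤ N + B + 3
  · obtain ⟨i, hi, hij, -⟩ := chainEdge_pred hB hM h0 hjM
    exact ⟨i, hi, hij⟩
  · exact ⟨0, h0, by unfold chainEdge; omega⟩

theorem switchedChain_connected (hB : 7 ≤ B) (hN : N % B = 0) :
    (ascendingGraph (N + B + 4 + s) (switchedChainEdge B N)).Connected := by
  have hM : (N + B) % B = 0 := by rw [Nat.add_mod_right, hN]
  have : NeZero (N + B + 4 + s) := ⟨by omega⟩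
  refine ascendingGraph_connected fun j hj h0 => ?_
  by_cases hjM : j ≤ N + B + 3
  · by_cases hj2 : j = N + B + 2
    · exact ⟨N + 6, by omega, Or.inr (Or.inr ⟨rfl, hj2⟩)⟩
    · obtain ⟨i, hi, hij, -, hmod⟩ := chainEdge_pred hB hM h0 hjM
      refine ⟨i, hi, Or.inl ⟨hij, ?_, by omega⟩⟩
      rintro ⟨rfl, rfl⟩
      exact hmod ⟨mod_add_of_mod_eq_zero hN (by omega), mod_add_of_mod_eq_zero hN (by omega)⟩
  · exact ⟨0, h0, Or.inl ⟨by unfold chainEdge; omega, by omega, by omega⟩⟩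

theorem chain_adj_pole_iff (hB : 7 ≤ B) (hN : N % B = 0) (p : Fin (N + B + 4 + s))
    (hp : p.val = N + 6) (y : Fin (N + B + 4 + s))
    (hy : ¬ (N + 6 ≤ y.val ∧ y.val ≤ N + B + 3)) :
    (ascendingGraph (N + B + 4 + s) (chainEdge B (N + B))).Adj y p ↔
      y.val = N + 4 ∨ y.val = N + 5 := by
  have h4 := mod_add_of_mod_eq_zero (c := 4) hN (by omega)
  have h5 := mod_add_of_mod_eq_zero (c := 5) hN (by omega)
  constructor
  · rintro (⟨h, (⟨-, ⟨h1, -⟩ | ⟨h1, -⟩⟩ | h1 | h1)⟩ | ⟨h, (⟨-, ⟨h1, -⟩ | ⟨h1, -⟩⟩ | h1 | h1)⟩) <;> omega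
  · rintro (h | h)
    · exact Or.inl ⟨by omega, Or.inl ⟨by omega, Or.inr ⟨by omega, by rw [h, h4]; omega⟩⟩⟩
    · exact Or.inl ⟨by omega, Or.inl ⟨by omega, Or.inl ⟨by omega, by rw [h, h5]; omega⟩⟩⟩

theorem chain_not_adj_last_pole (hB : 7 ≤ B) (q : Fin (N + B + 4 + s))
    (hq : q.val = N + B + 1) (y : Fin (N + B + 4 + s))
    (hy : ¬ (N + 6 ≤ y.val ∧ y.val ≤ N + B + 3)) :
    ¬ (ascendingGraph (N + B + 4 + s) (chainEdge B (N + B))).Adj y q := by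
  rintro (⟨h, (⟨-, ⟨h1, -⟩ | ⟨h1, -⟩⟩ | h1 | h1)⟩ | ⟨h, (⟨-, ⟨h1, -⟩ | ⟨h1, -⟩⟩ | h1 | h1)⟩) <;> omega

set_option maxHeartbeats 1000000 in
/-- The two chains have the same numbers of closed walks at position `0` up to the length at which
the switched edges are reached and not any longer. -/
theorem chain_closedWalks (hB : 7 ≤ B) (hN : N % B = 0)
    [DecidableRel (ascendingGraph (N + B + 4 + s) (chainEdge B (N + B))).Adj]
    [DecidableRel (ascendingGraph (N + B + 4 + s) (switchedChainEdge B N)).Adj]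
    (v : Fin (N + B + 4 + s)) (hv0 : v.val = 0) :
    (∀ k < 2 * (chainLevel B N + 3) + 2,
      ((ascendingGraph (N + B + 4 + s) (chainEdge B (N + B))).adjMatrix ℤ ^ k) v v =
        ((ascendingGraph (N + B + 4 + s) (switchedChainEdge B N)).adjMatrix ℤ ^ k) v v) ∧
    ((ascendingGraph (N + B + 4 + s) (chainEdge B (N + B))).adjMatrix ℤ ^
        (2 * (chainLevel B N + 3) + 2)) v v ≠
      ((ascendingGraph (N + B + 4 + s) (switchedChainEdge B N)).adjMatrix ℤ ^
        (2 * (chainLevel B N + 3) + 2)) v v := by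
  have hM : (N + B) % B = 0 := by rw [Nat.add_mod_right, hN]
  have hlt (x : Fin (N + B + 4 + s)) := truncatedLevel_lt_iff hB hN (i := x)
  have hv : truncatedLevel B N v = 0 := by simp [hv0, truncatedLevel, chainLevel]
  have hGd : ∀ x y, (ascendingGraph (N + B + 4 + s) (chainEdge B (N + B))).Adj x y →
      truncatedLevel B N y ≤ truncatedLevel B N x + 1 := by
    rintro x y (h | h)
    · exact (truncatedLevel_of_chainEdge hB hN h.2).1
    · exact (truncatedLevel_of_chainEdge hB hN h.2).2
  have hHd : ∀ x y, (ascendingGraph (N + B + 4 + s) (switchedChainEdge B N)).Adj x y →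
      truncatedLevel B N y ≤ truncatedLevel B N x + 1 := by
    rintro x y (h | h)
    · exact (truncatedLevel_of_switchedChainEdge hB hN h.2).1
    · exact (truncatedLevel_of_switchedChainEdge hB hN h.2).2
  -- Of the four switched edges, only those at N + 5 have an end within level R = `chainLevel B N +
  -- 3`.
  have hGH' : ∀ x y : Fin (N + B + 4 + s), truncatedLevel B N x ≤ chainLevel B N + 3 →
      (x.val ≠ N + 5 ∨ (y.val ≠ N + 6 ∧ y.val ≠ N + B + 1)) →
      ((ascendingGraph (N + B + 4 + s) (chainEdge B (N + B))).Adj x y ↔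
        (ascendingGraph (N + B + 4 + s) (switchedChainEdge B N)).Adj x y) := by
    intro x y hx hxy
    have hx' := (hlt x).not.mp hx.not_gt
    rw [switchedChain_adj]
    by_cases hg : (ascendingGraph (N + B + 4 + s) (chainEdge B (N + B))).Adj x y <;>
      simp only [hg, true_and, false_and, false_or, true_iff, false_iff] <;> omega
  have hGH : ∀ x y : Fin (N + B + 4 + s), truncatedLevel B N x ≤ chainLevel B N + 3 →
      truncatedLevel B N y ≤ chainLevel B N + 3 →
      ((ascendingGraph (N + B + 4 + s) (chainEdge B (N + B))).Adj x y ↔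
        (ascendingGraph (N + B + 4 + s) (switchedChainEdge B N)).Adj x y) := by
    intro x y hx hy
    have hy' := (hlt y).not.mp hy.not_gt
    exact hGH' x y hx (by omega)
  refine ⟨fun k hk => adjMatrix_pow_self_congr_of_level
    (d := fun x : Fin (N + B + 4 + s) => truncatedLevel B N x) hv hGd hHd hGH k (by omega), ?_⟩
  rw [← sub_ne_zero, adjMatrix_pow_self_sub_of_level
    (d := fun x : Fin (N + B + 4 + s) => truncatedLevel B N x) hv hGd hHd hGH]
  have hlow := adjMatrix_pow_congr_of_level
    (d := fun x : Fin (N + B + 4 + s) => truncatedLevel B N x) hv hGd hHd hGH _ le_rfl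
  have hGS := adjMatrix_pow_succ_apply_of_level (R := chainLevel B N + 3)
    (d := fun x : Fin (N + B + 4 + s) => truncatedLevel B N x) hv hGd
  have hHS := adjMatrix_pow_succ_apply_of_level (R := chainLevel B N + 3)
    (d := fun x : Fin (N + B + 4 + s) => truncatedLevel B N x) hv hHd
  obtain ⟨a, ha⟩ : ∃ b : Fin (N + B + 4 + s), b.val = N + 4 := ⟨⟨N + 4, by omega⟩, rfl⟩
  obtain ⟨b, hb⟩ : ∃ b : Fin (N + B + 4 + s), b.val = N + 5 := ⟨⟨N + 5, by omega⟩, rfl⟩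
  obtain ⟨p, hp⟩ : ∃ p : Fin (N + B + 4 + s), p.val = N + 6 := ⟨⟨N + 6, by omega⟩, rfl⟩
  obtain ⟨q, hq⟩ : ∃ q : Fin (N + B + 4 + s), q.val = N + B + 1 := ⟨⟨N + B + 1, by omega⟩, rfl⟩
  have hab : a ≠ b := by rw [ne_eq, Fin.ext_iff]; omega
  have hpq : p ≠ q := by rw [ne_eq, Fin.ext_iff]; omega
  have hGp := hGS p {a, b} (fun y hy => by
    rw [Finset.mem_insert, Finset.mem_singleton, Fin.ext_iff, Fin.ext_iff, ha, hb]
    exact chain_adj_pole_iff hB hN p hp y ((hlt y).not.mp hy.not_gt))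
  have hGq := hGS q ∅ (fun y hy => by
    rw [iff_false_right (Finset.notMem_empty y)]
    exact chain_not_adj_last_pole hB q hq y ((hlt y).not.mp hy.not_gt))
  have hHp := hHS p {a} (fun y hy => by
    have hy' := (hlt y).not.mp hy.not_gt
    rw [Finset.mem_singleton, Fin.ext_iff, switchedChain_adj, chain_adj_pole_iff hB hN p hp y hy']
    omega)
  have hHq := hHS q {b} (fun y hy => by
    have hy' := (hlt y).not.mp hy.not_gt
    have hadj := chain_not_adj_last_pole hB q hq y hy'
    rw [Finset.mem_singleton, Fin.ext_iff, switchedChain_adj]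
    simp only [hadj, false_and, false_or]
    omega)
  have hpos : ∀ x : Fin (N + B + 4 + s), (x.val = N + 4 ∨ x.val = N + 5) →
      0 < ((ascendingGraph (N + B + 4 + s) (chainEdge B (N + B))).adjMatrix ℤ ^
        (chainLevel B N + 3)) v x := by
    intro x hx
    have : NeZero (N + B + 4 + s) := ⟨by omega⟩
    have hlev := chainLevel_add_of_le hB hN
    obtain ⟨w, hw⟩ := ascendingGraph_exists_walk (n := N + B + 4 + s)
      (E := chainEdge B (N + B)) (chainLevel B) rfl (b := N + 5) (by omega)
      (fun j hj h0 => by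
        obtain ⟨i, hi, hij, h', -⟩ := chainEdge_pred hB hM h0 (show j ≤ N + B + 3 by omega)
        exact ⟨i, hi, hij, chainLevel_of_edge hB hij (by omega) h'⟩) x (by omega)
    have h1 := adjMatrix_pow_pos_of_walk w
    have h2 : chainLevel B x = chainLevel B N + 3 := by
      rcases hx with hx | hx <;> rw [hx] <;> omega
    have h3 : (0 : Fin (N + B + 4 + s)) = v := by rw [Fin.ext_iff, hv0]; rfl
    rw [hw, h2, h3] at h1
    exact h1
  -- With a and b the numbers of walks of length R to the vertices `a` and `b`, the difference is (a
  -- + b)² + 0 - a² - b² = 2ab.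
  rw [← Finset.sum_subset (s₁ := {p, q}), Finset.sum_pair hpq, hGp, hGq, hHp, hHq,
    Finset.sum_pair hab, Finset.sum_empty, Finset.sum_singleton, Finset.sum_singleton, ← hlow, ← hlow]
  · have h1 := mul_pos (hpos a (Or.inl ha)) (hpos b (Or.inr hb))
    apply ne_of_gt
    linarith
  · intro x hx
    rw [Finset.mem_insert, Finset.mem_singleton, Fin.ext_iff, Fin.ext_iff] at hx
    rw [Finset.mem_filter]
    exact ⟨Finset.mem_univ _, (hlt x).mpr (by omega)⟩
  · intro x _ hx
    rw [Finset.mem_insert, Finset.mem_singleton, Fin.ext_iff, Fin.ext_iff] at hx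
    have h1 := hGS x (Finset.univ.filter fun y =>
      (ascendingGraph (N + B + 4 + s) (switchedChainEdge B N)).Adj y x) (by
        intro y hy
        rw [Finset.mem_filter, hGH' y x hy (by omega)]
        simp)
    have h2 := hHS x (Finset.univ.filter fun y =>
      (ascendingGraph (N + B + 4 + s) (switchedChainEdge B N)).Adj y x) (by simp)
    rw [h1, h2, Finset.sum_congr rfl fun y _ => hlow y, sub_self]

end

/-! ### Choice of parameters and the final assembly. -/

/-- The two chains have the same walk counts at position `0` up to a length that depends linearly
on the number of hexagons and the distance between them, and not for all lengths. -/
theorem exists_walkCount_eq_of_lt {B s : ℕ} (hB : 7 ≤ B) (hs : s ≠ 1) (q : ℕ) :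
    ∃ (G H : SimpleGraph (Fin (q * B + B + 4 + s))) (v : Fin (q * B + B + 4 + s)),
      G.Connected ∧ H.Connected ∧ ¬ WalkEquivalent G H v v ∧
      ∀ k ≤ 2 * (q * (B - 2) + 3) + 2, walkCount G v k = walkCount H v k := by
  classical
  have hN : q * B % B = 0 := Nat.mul_mod_left q B
  have hcl := chain_closedWalks (s := s) hB hN ⟨0, by omega⟩ rfl
  have hw := sum_adjMatrix_pow_of_common_profile
    (G := ascendingGraph (q * B + B + 4 + s) (chainEdge B (q * B + B)))
    (H := ascendingGraph (q * B + B + 4 + s) (switchedChainEdge B (q * B)))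
    ⟨0, by omega⟩ (fun k x => leafedProfile B (q * B + B) k x) (chainDefect B (q * B) s)
    (fun x => leafedProfile_zero _) (fun k x => leafedProfile_succ_chain hB hN k x)
    (fun k x => by
      rw [sum_adj_switchedChain hB hN]
      exact leafedProfile_succ_chain hB hN k x)
    (by rw [chainDefect_zero hB]; omega) _ hcl.1 hcl.2
  rw [chainLevel_mul hB] at hw
  refine ⟨_, _, ⟨0, by omega⟩, chain_connected hB hN, switchedChain_connected hB hN,
    fun h => hw.2 ?_, fun k hk => ?_⟩
  · rw [← walkCount_eq_sum_adjMatrix_pow, ← walkCount_eq_sum_adjMatrix_pow, h]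
  · have := hw.1 k hk
    rw [← walkCount_eq_sum_adjMatrix_pow, ← walkCount_eq_sum_adjMatrix_pow] at this
    exact_mod_cast this

/-- Walk counts of large graphs can agree up to length almost twice the number of vertices. -/
theorem exists_walkCount_eq_of_large {n : ℕ} (hn : 64 < n) :
    ∃ (G H : SimpleGraph (Fin n)) (v : Fin n), G.Connected ∧ H.Connected ∧
      ¬ WalkEquivalent G H v v ∧
      ∀ k : ℕ, (k : ℝ) < 2 * (n : ℝ) - 16 * Real.sqrt (n : ℝ) →
        walkCount G v k = walkCount H v k := by
  obtain ⟨m, hm1, hm2⟩ : ∃ m, m * m ≤ n ∧ n < (m + 1) * (m + 1) :=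
    ⟨n.sqrt, n.sqrt_le, n.lt_succ_sqrt⟩
  have hm8 : 8 ≤ m := by
    by_contra h
    have : (m + 1) * (m + 1) ≤ 8 * 8 := Nat.mul_le_mul (by omega) (by omega)
    omega
  obtain ⟨q, rfl⟩ : ∃ q, m = q + 1 := ⟨m - 1, by omega⟩
  -- With q + 1 = ⌊√n⌋ blocks of length B, the remainder t is absorbed by t + 2 leaves. Reserving 6
  -- = 4 + 2 vertices guarantees at least two leaves, so the defect is nonzero.
  obtain ⟨B, t, hdiv, ht⟩ : ∃ B t, (q + 1) * B + t = n - 6 ∧ t < q + 1 :=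
    ⟨_, _, Nat.div_add_mod (n - 6) (q + 1), Nat.mod_lt _ (by omega)⟩
  have hB : 7 ≤ B := by
    by_contra h
    have : (q + 1) * B ≤ (q + 1) * 6 := Nat.mul_le_mul le_rfl (by omega)
    have : (q + 1) * 8 ≤ (q + 1) * (q + 1) := Nat.mul_le_mul le_rfl (by omega)
    omega
  have hBle : B ≤ q + 2 := by
    by_contra h
    have : (q + 1) * (q + 3) ≤ (q + 1) * B := Nat.mul_le_mul le_rfl (by omega)
    have : (q + 1 + 1) * (q + 1 + 1) = (q + 1) * (q + 3) + 1 := by ring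
    omega
  have hsplit : (q + 1) * B = q * B + B := by ring
  obtain rfl : n = q * B + B + 4 + (t + 2) := by omega
  obtain ⟨G, H, v, hG, hH, hne, heq⟩ := exists_walkCount_eq_of_lt (s := t + 2) hB (by omega) q
  refine ⟨G, H, v, hG, hH, hne, fun k hk => heq k ?_⟩
  have hsq : ((q + 1 : ℕ) : ℝ) ≤ Real.sqrt ((q * B + B + 4 + (t + 2) : ℕ) : ℝ) := by
    apply Real.le_sqrt_of_sq_le
    rw [sq]
    exact_mod_cast hm1
  have hk' : (k : ℝ) + 16 * ((q + 1 : ℕ) : ℝ) < 2 * ((q * B + B + 4 + (t + 2) : ℕ) : ℝ) := by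
    linarith
  have hk'' : k + 16 * (q + 1) < 2 * (q * B + B + 4 + (t + 2)) := by exact_mod_cast hk'
  have hqB : q * (B - 2) + 2 * q = q * B := by
    obtain ⟨C, hC⟩ : ∃ C, B = C + 2 := ⟨B - 2, by omega⟩
    rw [hC, Nat.add_sub_cancel]
    ring
  -- The shortfall from 2n is 2B + 2t + 4q + 4 ≤ 8(q + 1), using B ≤ q + 2 and t ≤ q.
  omega

theorem theorem5 :
    -- Part 1
    (∀ {V W : Type*} [Fintype V] [Fintype W] (G : SimpleGraph V) (H : SimpleGraph W) (n m : ℕ),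
      Fintype.card V = n → Fintype.card W = m → G.Connected → H.Connected →
      ∀ (v : V) (u : W),
        (WalkEquivalent G H v u ↔ ∀ k : ℕ, k < n + m → walkCount G v k = walkCount H u k) ∧
        (ClosedWalkEquivalent G H v u ↔
          ∀ k : ℕ, k < n + m → closedWalkCount G v k = closedWalkCount H u k)) ∧
    -- Part 2
    (∀ n : ℕ, 2 ≤ n → ∃ (G H : SimpleGraph (Fin n)) (v u : Fin n),
      (3 ≤ n → G.Connected ∧ H.Connected) ∧
      ¬ ClosedWalkEquivalent G H v u ∧
      ∀ k : ℕ, (k : ℤ) ≤ 2 * (n : ℤ) - 5 → closedWalkCount G v k = closedWalkCount H u k) ∧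
    -- Part 3
    (∀ n : ℕ, 2 ≤ n → ∃ (G H : SimpleGraph (Fin n)) (v u : Fin n),
      (3 ≤ n → G.Connected ∧ H.Connected) ∧
      ¬ WalkEquivalent G H v u ∧
      ∀ k : ℕ, (k : ℝ) < 2 * (n : ℝ) - 16 * Real.sqrt (n : ℝ) →
        walkCount G v k = walkCount H u k) := by
  classical
  refine ⟨?_, fun n hn => ?_, fun n hn => ?_⟩
  · rintro V W _ _ G H _ _ rfl rfl - - v u
    exact ⟨walkEquivalent_iff_lt_card G H v u, closedWalkEquivalent_iff_lt_card G H v u⟩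
  · obtain rfl | hn := hn.eq_or_lt
    -- For n = 2 the integer bound is -1, so no k qualifies.
    · refine ⟨⊤, ⊥, 0, 0, by omega, fun h => ?_, fun k hk => by push_cast at hk; omega⟩
      have := h 2
      rw [closedWalkCount_two, closedWalkCount_two] at this
      simp at this
    · obtain ⟨G, H, v, hG, hH, hne, heq⟩ := exists_closedWalkCount_eq_of_le hn
      exact ⟨G, H, v, v, fun _ => ⟨hG, hH⟩, hne, fun k hk => heq k (by omega)⟩
  · rcases Nat.lt_or_ge 64 n with h64 | h64
    · obtain ⟨G, H, v, hG, hH, hne, heq⟩ := exists_walkCount_eq_of_large h64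
      exact ⟨G, H, v, v, fun _ => ⟨hG, hH⟩, hne, heq⟩
    -- For n ≤ 64 the range of k is empty, so any two vertices of different degree suffice.
    have hvac : 2 * (n : ℝ) - 16 * Real.sqrt (n : ℝ) ≤ 0 := by
      have h1 : Real.sqrt (n : ℝ) ≤ 8 := by
        rw [Real.sqrt_le_left (by norm_num)]
        norm_num
        exact_mod_cast h64
      have h2 := Real.mul_self_sqrt (Nat.cast_nonneg (α := ℝ) n)
      have h3 := Real.sqrt_nonneg (n : ℝ)
      nlinarith
    have hk (k : ℕ) (h : (k : ℝ) < 2 * (n : ℝ) - 16 * Real.sqrt (n : ℝ)) : False := by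
      have := Nat.cast_nonneg (α := ℝ) k
      linarith
    obtain rfl | hn := hn.eq_or_lt
    · refine ⟨⊤, ⊥, 0, 0, by omega, fun h => ?_, fun k h => (hk k h).elim⟩
      have := h 1
      rw [walkCount_one, walkCount_one] at this
      simp at this
    · obtain ⟨m, rfl⟩ := Nat.exists_eq_add_of_le' hn
      refine ⟨⊤, SimpleGraph.pathGraph _, 0, 0, fun _ =>
        ⟨SimpleGraph.connected_top, SimpleGraph.pathGraph_connected _⟩, fun h => ?_,
        fun k h => (hk k h).elim⟩
      have := h 1
      rw [walkCount_one, walkCount_one] at this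
      have hdeg : (SimpleGraph.pathGraph (m + 2 + 1)).degree 0 = 1 := by
        rw [SimpleGraph.degree_eq_one_iff_existsUnique_adj]
        refine ⟨1, ?_, fun y hy => ?_⟩
        · simp [SimpleGraph.pathGraph_adj]
        · replace hy := SimpleGraph.pathGraph_adj.mp hy
          rw [Fin.ext_iff, Fin.val_one]
          simp only [Fin.val_zero] at hy
          omega
      simp [hdeg] at this
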